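/- Let $0<\alpha<1$, $a>0$, $T>0$ and $\Omega=(0,a)\times(0,T]$, so that $\overline\Omega=[0,a]\times[0,T]$. For $0<\beta<1$ let $$D_{*t}^{\beta}u(x,t)=\frac{1}{1-\beta}\int_0^t \frac{\partial u}{\partial s}(x,s)\,E_{\beta,1}\!\left[-\beta\,\frac{(t-s)^{\beta}}{1-\beta}\right]ds,\qquad E_{\beta,\gamma}(z)=\sum_{k=0}^\infty\frac{z^k}{\Gamma(\beta k+\gamma)},$$ be the Atangana–Baleanu fractional derivative of order $\beta$ in $t$ (with normalization $M(\beta)=1$). Let $F\colon\overline\Omega\to\mathbb R$, $\varphi\colon[0,a]\to\mathbb R$ and $\lambda,\mu\colon[0,T]\to\mathbb R$ be continuous, with $\lambda$ and $\mu$ nondecreasing. Let $u\in C(\overline\Omega)\cap C^{2,1}(\Omega)$ be a classical solution of $$\frac{\partial u}{\partial t}(x,t)=\frac{\partial^2}{\partial x^2}D_{*t}^{1-\alpha}u(x,t)+F(x,t)\quad\text{in }\Omega,$$ $$u(x,0)=\varphi(x)\ (0\le x\le a),\qquad u(0,t)=\lambda(t),\quad u(a,t)=\mu(t)\ (0\le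 t\le T);$$ this includes that $u_t(x,\cdot)$ is integrable on $(0,T)$ for every $x\in(0,a)$, so that $D_{*t}^{1-\alpha}u$ is defined, and that $\frac{\partial^2}{\partial x^2}D_{*t}^{1-\alpha}u$ exists in $\Omega$. If $F\ge 0$ on $\overline\Omega$, then $$u(x,t)\ \ge\ \min\Big\{\min_{[0,T]}\lambda,\ \min_{[0,T]}\mu,\ \min_{[0,a]}\varphi\Big\}\qquad\text{for all }(x,t)\in\overline\Omega .$$ -/

import Mathlib

open Set MeasureTheory

namespace ABDiffusion

noncomputable section

/-- The two-parameter Mittag-Leffler function `E_{α,β}(z) = ∑ z^k / Γ(α k + β)` of a real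
argument. The series converges for every `z` when `α, β > 0`. -/
def mittagLeffler (α β z : ℝ) : ℝ :=
  ∑' k : ℕ, z ^ k / Real.Gamma (α * k + β)

/-- The Atangana-Baleanu fractional derivative of order `α ∈ (0, 1)` with lower terminal `b` and
normalization `M(α) = 1`:
`(1 / (1 - α)) ∫_b^t f'(s) E_{α,1}[-α (t - s)^α / (1 - α)] ds`.
It depends on `f` only through the values of `f` on `(b, t)`. -/
def abDeriv (α b : ℝ) (f : ℝ → ℝ) (t : ℝ) : ℝ :=
  1 / (1 - α) * ∫ s in b..t, deriv f s * mittagLeffler α 1 (-α * ((t - s) ^ α / (1 - α)))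

/-- The partial derivative `∂v/∂x`. -/
def dx (v : ℝ → ℝ → ℝ) (x t : ℝ) : ℝ :=
  deriv (fun y => v y t) x

/-- The partial derivative `∂v/∂t` of a function given for `0 ≤ t ≤ T` (one-sided at `t = T`). -/
def dt (T : ℝ) (v : ℝ → ℝ → ℝ) (x t : ℝ) : ℝ :=
  derivWithin (fun s => v x s) (Icc 0 T) t

/-- The function `D_{*t}^{1-α} v`, the Atangana-Baleanu derivative of order `1 - α` of `v` in its
second variable, with lower terminal `0`. -/
def abTime (α : ℝ) (v : ℝ → ℝ → ℝ) (x t : ℝ) : ℝ :=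
  abDeriv (1 - α) 0 (fun s => v x s) t

/-- `v ∈ C^{2,1}((0,a) × (0,T])`: the derivatives `v_x`, `v_xx`, `v_t` exist and are continuous. -/
structure IsC21 (a T : ℝ) (v : ℝ → ℝ → ℝ) : Prop where
  differentiable_x : ∀ x ∈ Ioo 0 a, ∀ t ∈ Ioc 0 T, DifferentiableAt ℝ (fun y => v y t) x
  differentiable_xx : ∀ x ∈ Ioo 0 a, ∀ t ∈ Ioc 0 T, DifferentiableAt ℝ (fun y => dx v y t) x
  differentiable_t : ∀ x ∈ Ioo 0 a, ∀ t ∈ Ioc 0 T,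
    DifferentiableWithinAt ℝ (fun s => v x s) (Icc 0 T) t
  continuous_x : ContinuousOn (fun p : ℝ × ℝ => dx v p.1 p.2) (Ioo 0 a ×ˢ Ioc 0 T)
  continuous_xx : ContinuousOn (fun p : ℝ × ℝ => dx (dx v) p.1 p.2) (Ioo 0 a ×ˢ Ioc 0 T)
  continuous_t : ContinuousOn (fun p : ℝ × ℝ => dt T v p.1 p.2) (Ioo 0 a ×ˢ Ioc 0 T)

/-- `u` is a classical solution of `u_t = ∂²/∂x² D_{*t}^{1-α} u + F` in `(0,a) × (0,T]` with
`u(x,0) = φ(x)` for `0 ≤ x ≤ a` and `u(0,t) = lam(t)`, `u(a,t) = mu(t)` for `0 ≤ t ≤ T`. -/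
structure IsClassicalSolution (α a T : ℝ) (F : ℝ → ℝ → ℝ) (φ lam mu : ℝ → ℝ)
    (u : ℝ → ℝ → ℝ) : Prop where
  continuous : ContinuousOn (fun p : ℝ × ℝ => u p.1 p.2) (Icc 0 a ×ˢ Icc 0 T)
  isC21 : IsC21 a T u
  /-- `u_t(x,·)` is integrable up to `t = 0`, so that the integral defining `D_{*t}^{1-α} u`
  exists. (The kernel is bounded, so this is weaker than `u(x,·) ∈ W^1_2([0,T])`.) -/
  integrable_t : ∀ x ∈ Ioo 0 a, IntegrableOn (fun t => dt T u x t) (Ioc 0 T) volume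
  /-- The first and second `x`-derivatives of `D_{*t}^{1-α} u` exist. -/
  ab_differentiable_x : ∀ x ∈ Ioo 0 a, ∀ t ∈ Ioc 0 T,
    DifferentiableAt ℝ (fun y => abTime α u y t) x
  ab_differentiable_xx : ∀ x ∈ Ioo 0 a, ∀ t ∈ Ioc 0 T,
    DifferentiableAt ℝ (fun y => dx (abTime α u) y t) x
  equation : ∀ x ∈ Ioo 0 a, ∀ t ∈ Ioc 0 T,
    dt T u x t = dx (dx (abTime α u)) x t + F x t
  initial : ∀ x ∈ Icc 0 a, u x 0 = φ x
  boundary_left : ∀ t ∈ Icc 0 T, u 0 t = lam t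
  boundary_right : ∀ t ∈ Icc 0 T, u a t = mu t

end

end ABDiffusion

/-!
Put `β = 1 - α`, let `w(x, t) = u(x, t) - u(x, 0)` and let `v = D_{*t}^β u`. The minimum principle is
proved for `v` instead of `u`, and gives the stronger bound `u(x, t) ≥ φ(x)`.

The Atangana–Baleanu derivative is inverted by the Volterra equation `(1 - β) v + β I^β v = w`, where
`I^β` is the Riemann–Liouville integral (`abSeries_add_fracInt_abSeries`). Expanding the
Mittag-Leffler kernel and integrating each term by parts writes `v` as the Neumann series of this
equation (`abDeriv_eq_abSeries`). The series involves only `w`, not its time derivative, and therefore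
extends `v` continuously to the closed rectangle, although `u_t` is only known in the interior.

Suppose that the extended `v` has a negative minimum over the closed rectangle, at `(x₀, t₀)`. Then
`t₀ > 0`, as `v(·, 0) = 0`. Because the kernel of `I^β` decreases, the Volterra equation forces
`w(x₀, t₀) - w(x₀, t₁) ≤ v(x₀, t₀) (t₀^β - t₁^β) / Γ(β) < 0` for some `t₁ < t₀` arbitrarily close to
`t₀` (`exists_volterra_sub_le_of_min`). On the lateral boundary this contradicts the monotonicity of
the boundary values. In the interior it gives `u_t(x₀, t₀) < 0`, while `v_xx ≥ 0` at the minimum, so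
that the equation and `F ≥ 0` give `u_t ≥ 0`. Hence `v ≥ 0` everywhere
(`IsClassicalSolution.abSeries_nonneg`), and `w = (1 - β) v + β I^β v ≥ 0`.
-/

namespace ABDiffusion

/-! ### Riemann–Liouville integrals -/

/-- The Riemann–Liouville integral `I^γ f (t) = (1 / Γ(γ)) ∫_0^t (t - s)^(γ - 1) f(s) ds` of order
`γ ≥ 0`, with the convention that `I^0` is the identity. -/
noncomputable def fracInt (γ : ℝ) (f : ℝ → ℝ) (t : ℝ) : ℝ :=
  if γ = 0 then f t else 1 / Real.Gamma γ * ∫ s in (0 : ℝ)..t, (t - s) ^ (γ - 1) * f s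

theorem fracInt_zero (f : ℝ → ℝ) (t : ℝ) : fracInt 0 f t = f t := if_pos rfl

theorem fracInt_of_pos {γ : ℝ} (hγ : 0 < γ) (f : ℝ → ℝ) (t : ℝ) :
    fracInt γ f t = 1 / Real.Gamma γ * ∫ s in (0 : ℝ)..t, (t - s) ^ (γ - 1) * f s :=
  if_neg hγ.ne'

theorem intervalIntegrable_sub_rpow {γ : ℝ} (hγ : 0 < γ) (t a b : ℝ) :
    IntervalIntegrable (fun s => (t - s) ^ (γ - 1)) volume a b := by
  have h := (intervalIntegral.intervalIntegrable_rpow' (a := t - a) (b := t - b)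
    (r := γ - 1) (by linarith)).comp_sub_left t
  simpa using h

theorem integral_sub_rpow {γ : ℝ} (hγ : 0 < γ) (t a b : ℝ) :
    ∫ s in a..b, (t - s) ^ (γ - 1) = ((t - a) ^ γ - (t - b) ^ γ) / γ := by
  rw [intervalIntegral.integral_comp_sub_left (fun r => r ^ (γ - 1)),
    integral_rpow (Or.inl (by linarith))]
  simp

theorem fracInt_congr {γ : ℝ} {f g : ℝ → ℝ} {t : ℝ} (ht : 0 ≤ t)
    (h : ∀ s ∈ Icc 0 t, f s = g s) : fracInt γ f t = fracInt γ g t := by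
  unfold fracInt
  split_ifs with h0
  · exact h t (right_mem_Icc.2 ht)
  · congr 1
    refine intervalIntegral.integral_congr fun s hs => ?_
    rw [uIcc_of_le ht] at hs
    simp only [h s hs]

theorem fracInt_const_mul (γ c : ℝ) (f : ℝ → ℝ) (t : ℝ) :
    fracInt γ (fun s => c * f s) t = c * fracInt γ f t := by
  unfold fracInt
  split_ifs with h0
  · rfl
  · simp only [mul_left_comm _ c, intervalIntegral.integral_const_mul]

theorem intervalIntegrable_sub_rpow_mul {γ : ℝ} (hγ : 0 < γ) {f : ℝ → ℝ} {a b : ℝ} (hab : a ≤ b)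
    (hf : ContinuousOn f (Icc a b)) (t : ℝ) :
    IntervalIntegrable (fun s => (t - s) ^ (γ - 1) * f s) volume a b :=
  (intervalIntegrable_sub_rpow hγ t a b).mul_continuousOn (by rwa [uIcc_of_le hab])

theorem fracInt_add {γ : ℝ} (hγ : 0 ≤ γ) {f g : ℝ → ℝ} {t : ℝ} (ht : 0 ≤ t)
    (hf : ContinuousOn f (Icc 0 t)) (hg : ContinuousOn g (Icc 0 t)) :
    fracInt γ (fun s => f s + g s) t = fracInt γ f t + fracInt γ g t := by
  rcases hγ.eq_or_lt with rfl | hγ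
  · simp only [fracInt_zero]
  · simp only [fracInt_of_pos hγ]
    rw [← mul_add, ← intervalIntegral.integral_add (intervalIntegrable_sub_rpow_mul hγ ht hf t)
      (intervalIntegrable_sub_rpow_mul hγ ht hg t)]
    congr 2
    ext s
    ring

theorem fracInt_sub {γ : ℝ} (hγ : 0 ≤ γ) {f g : ℝ → ℝ} {t : ℝ} (ht : 0 ≤ t)
    (hf : ContinuousOn f (Icc 0 t)) (hg : ContinuousOn g (Icc 0 t)) :
    fracInt γ (fun s => f s - g s) t = fracInt γ f t - fracInt γ g t := by
  have h := fracInt_add hγ ht hf (g := fun s => -1 * g s) (continuousOn_const.mul hg)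
  rw [fracInt_const_mul] at h
  simp only [neg_mul, one_mul, ← sub_eq_add_neg] at h
  exact h

theorem fracInt_nonneg {γ : ℝ} (hγ : 0 ≤ γ) {f : ℝ → ℝ} {t : ℝ} (ht : 0 ≤ t)
    (hf : ∀ s ∈ Icc 0 t, 0 ≤ f s) : 0 ≤ fracInt γ f t := by
  rcases hγ.eq_or_lt with rfl | hγ
  · rw [fracInt_zero]
    exact hf t (right_mem_Icc.2 ht)
  · rw [fracInt_of_pos hγ]
    refine mul_nonneg (one_div_nonneg.2 (Real.Gamma_pos_of_pos hγ).le)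
      (intervalIntegral.integral_nonneg ht fun s hs => mul_nonneg ?_ (hf s hs))
    exact Real.rpow_nonneg (by linarith [hs.2]) _

theorem abs_fracInt_le {γ : ℝ} (hγ : 0 ≤ γ) {f : ℝ → ℝ} {t M : ℝ} (ht : 0 ≤ t)
    (hM : ∀ s ∈ Icc 0 t, |f s| ≤ M) :
    |fracInt γ f t| ≤ M * (t ^ γ / Real.Gamma (γ + 1)) := by
  rcases hγ.eq_or_lt with rfl | hγ
  · simpa [fracInt_zero] using hM t (right_mem_Icc.2 ht)
  · have hΓ := Real.Gamma_pos_of_pos hγ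
    have h1 : |∫ s in (0 : ℝ)..t, (t - s) ^ (γ - 1) * f s| ≤
        ∫ s in (0 : ℝ)..t, M * (t - s) ^ (γ - 1) := by
      rw [← Real.norm_eq_abs]
      refine intervalIntegral.norm_integral_le_of_norm_le ht ?_
        ((intervalIntegrable_sub_rpow hγ t 0 t).const_mul M)
      refine Filter.Eventually.of_forall fun s hs => ?_
      have h0 : 0 ≤ (t - s) ^ (γ - 1) := Real.rpow_nonneg (by linarith [hs.2]) _
      rw [norm_mul, Real.norm_of_nonneg h0, mul_comm]
      exact mul_le_mul_of_nonneg_right (hM s ⟨hs.1.le, hs.2⟩) h0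
    rw [intervalIntegral.integral_const_mul, integral_sub_rpow hγ, sub_self, sub_zero,
      Real.zero_rpow hγ.ne', sub_zero] at h1
    rw [fracInt_of_pos hγ, abs_mul, abs_of_pos (one_div_pos.2 hΓ), Real.Gamma_add_one hγ.ne']
    calc _ ≤ 1 / Real.Gamma γ * (M * (t ^ γ / γ)) :=
          mul_le_mul_of_nonneg_left h1 (one_div_pos.2 hΓ).le
      _ = _ := by field_simp

/-- The substitution `s = t σ` moves the `t`-dependence out of the singular kernel. -/
theorem fracInt_eq_integral_unit {γ : ℝ} (hγ : 0 < γ) (f : ℝ → ℝ) {t : ℝ} (ht : 0 ≤ t) :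
    fracInt γ f t =
      t ^ γ / Real.Gamma γ * ∫ σ in (0 : ℝ)..1, (1 - σ) ^ (γ - 1) * f (t * σ) := by
  rw [fracInt_of_pos hγ]
  rcases ht.eq_or_lt with rfl | ht
  · simp [Real.zero_rpow hγ.ne']
  · have h := intervalIntegral.mul_integral_comp_mul_left (a := 0) (b := 1)
      (f := fun s => (t - s) ^ (γ - 1) * f s) t
    rw [mul_zero, mul_one] at h
    have h2 : ∫ σ in (0 : ℝ)..1, (t - t * σ) ^ (γ - 1) * f (t * σ) =
        t ^ (γ - 1) * ∫ σ in (0 : ℝ)..1, (1 - σ) ^ (γ - 1) * f (t * σ) := by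
      rw [← intervalIntegral.integral_const_mul]
      refine intervalIntegral.integral_congr fun σ hσ => ?_
      rw [uIcc_of_le zero_le_one] at hσ
      have : t - t * σ = t * (1 - σ) := by ring
      simp only [this]
      rw [Real.mul_rpow ht.le (by linarith [hσ.2])]
      ring
    rw [← h, h2, ← mul_assoc t, mul_comm t, ← Real.rpow_add_one ht.ne']
    simp only [sub_add_cancel]
    ring

/-- The fractional integral in the second variable of a jointly continuous function is jointly
continuous. -/
theorem continuousOn_fracInt {γ : ℝ} (hγ : 0 ≤ γ) {f : ℝ → ℝ → ℝ}
    (hf : Continuous fun p : ℝ × ℝ => f p.1 p.2) :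
    ContinuousOn (fun p : ℝ × ℝ => fracInt γ (f p.1) p.2) (univ ×ˢ Ici 0) := by
  rcases hγ.eq_or_lt with rfl | hγ
  · simpa only [fracInt_zero] using hf.continuousOn
  have key : Continuous fun p : ℝ × ℝ =>
      ∫ σ in (0 : ℝ)..1, (1 - σ) ^ (γ - 1) * f p.1 (p.2 * σ) := by
    refine continuous_iff_continuousAt.2 fun p₀ => ?_
    obtain ⟨C, hC⟩ := ((isCompact_closedBall p₀.1 1).prod
      (isCompact_closedBall (0 : ℝ) (|p₀.2| + 1))).exists_bound_of_continuousOn hf.continuousOn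
    refine intervalIntegral.continuousAt_of_dominated_interval
      (bound := fun σ => (1 - σ) ^ (γ - 1) * C) ?_ ?_
      ((intervalIntegrable_sub_rpow hγ 1 0 1).mul_const C) ?_
    · refine Filter.Eventually.of_forall fun p => ?_
      have hc : Continuous fun σ : ℝ => f p.1 (p.2 * σ) :=
        hf.comp (continuous_const.prodMk (continuous_const.mul continuous_id))
      have := (intervalIntegrable_sub_rpow_mul hγ zero_le_one hc.continuousOn 1).def'
      exact this.aestronglyMeasurable
    · filter_upwards [Metric.closedBall_mem_nhds p₀ one_pos] with p hp
      refine Filter.Eventually.of_forall fun σ hσ => ?_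
      rw [uIoc_of_le zero_le_one] at hσ
      have h0 : 0 ≤ (1 - σ) ^ (γ - 1) := Real.rpow_nonneg (by linarith [hσ.2]) _
      rw [norm_mul, Real.norm_of_nonneg h0]
      refine mul_le_mul_of_nonneg_left (hC (p.1, p.2 * σ) ⟨?_, ?_⟩) h0
      · rw [Metric.mem_closedBall] at hp ⊢
        exact (le_max_left _ _).trans hp
      · rw [Metric.mem_closedBall] at hp ⊢
        have h1 : |p.2 - p₀.2| ≤ 1 := (le_max_right _ _).trans hp
        have h2 : |p.2| ≤ |p₀.2| + 1 := by
          have := abs_sub_abs_le_abs_sub p.2 p₀.2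
          linarith
        simp only [dist_zero_right, Real.norm_eq_abs, abs_mul, abs_of_pos hσ.1]
        exact (mul_le_of_le_one_right (abs_nonneg _) hσ.2).trans h2
    · refine Filter.Eventually.of_forall fun σ _ => Continuous.continuousAt ?_
      exact continuous_const.mul
        (hf.comp (continuous_fst.prodMk (continuous_snd.mul continuous_const)))
  have h2 : Continuous fun p : ℝ × ℝ => p.2 ^ γ / Real.Gamma γ *
      ∫ σ in (0 : ℝ)..1, (1 - σ) ^ (γ - 1) * f p.1 (p.2 * σ) :=
    ((continuous_snd.rpow_const fun _ => Or.inr hγ.le).div_const _).mul key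
  exact h2.continuousOn.congr fun p hp => fracInt_eq_integral_unit hγ _ hp.2

theorem continuousOn_fracInt_right {γ : ℝ} (hγ : 0 ≤ γ) {f : ℝ → ℝ} (hf : Continuous f) (T : ℝ) :
    ContinuousOn (fracInt γ f) (Icc 0 T) :=
  (continuousOn_fracInt hγ (f := fun _ => f) (hf.comp continuous_snd)).comp
    (f := fun t : ℝ => ((0 : ℝ), t)) (by fun_prop) fun _ ht => ⟨mem_univ _, ht.1⟩

theorem integral_rpow_mul_one_sub_rpow {p q : ℝ} (hp : 0 < p) (hq : 0 < q) :
    ∫ σ in (0 : ℝ)..1, σ ^ (p - 1) * (1 - σ) ^ (q - 1) =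
      Real.Gamma p * Real.Gamma q / Real.Gamma (p + q) := by
  have h := Complex.Gamma_mul_Gamma_eq_betaIntegral (s := p) (t := q) (by simpa) (by simpa)
  have h2 : Complex.betaIntegral p q =
      ((∫ σ in (0 : ℝ)..1, σ ^ (p - 1) * (1 - σ) ^ (q - 1) : ℝ) : ℂ) := by
    rw [Complex.betaIntegral, ← intervalIntegral.integral_ofReal]
    refine intervalIntegral.integral_congr fun σ hσ => ?_
    rw [uIcc_of_le zero_le_one] at hσ
    simp only [Complex.ofReal_mul]
    rw [Complex.ofReal_cpow hσ.1, Complex.ofReal_cpow (by linarith [hσ.2])]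
    push_cast
    rfl
  rw [h2, ← Complex.ofReal_add, Complex.Gamma_ofReal, Complex.Gamma_ofReal,
    Complex.Gamma_ofReal] at h
  norm_cast at h
  rw [h, mul_div_cancel_left₀ _ (Real.Gamma_pos_of_pos (by linarith)).ne']

theorem fracInt_rpow {γ p : ℝ} (hγ : 0 ≤ γ) (hp : 0 ≤ p) {t : ℝ} (ht : 0 ≤ t) :
    fracInt γ (fun s => s ^ p) t =
      Real.Gamma (p + 1) / Real.Gamma (p + 1 + γ) * t ^ (p + γ) := by
  rcases hγ.eq_or_lt with rfl | hγ
  · rw [fracInt_zero, add_zero, add_zero, div_self (Real.Gamma_pos_of_pos (by linarith)).ne',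
      one_mul]
  rw [fracInt_eq_integral_unit hγ _ ht]
  have h : ∫ σ in (0 : ℝ)..1, (1 - σ) ^ (γ - 1) * (t * σ) ^ p =
      t ^ p * ∫ σ in (0 : ℝ)..1, σ ^ (p + 1 - 1) * (1 - σ) ^ (γ - 1) := by
    rw [← intervalIntegral.integral_const_mul]
    refine intervalIntegral.integral_congr fun σ hσ => ?_
    rw [uIcc_of_le zero_le_one] at hσ
    simp only [add_sub_cancel_right]
    rw [Real.mul_rpow ht hσ.1]
    ring
  rw [h, integral_rpow_mul_one_sub_rpow (by linarith) hγ, Real.rpow_add' ht (by linarith)]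
  have := (Real.Gamma_pos_of_pos hγ).ne'
  field_simp

theorem fracInt_fracInt_polynomial {β γ : ℝ} (hβ : 0 ≤ β) (hγ : 0 ≤ γ) (P : Polynomial ℝ)
    {t : ℝ} (ht : 0 ≤ t) :
    fracInt β (fracInt γ fun s => P.eval s) t = fracInt (β + γ) (fun s => P.eval s) t := by
  induction P using Polynomial.induction_on' with
  | add P Q hP hQ =>
    simp only [Polynomial.eval_add]
    rw [fracInt_add (add_nonneg hβ hγ) ht P.continuous.continuousOn Q.continuous.continuousOn,
      ← hP, ← hQ, ← fracInt_add hβ ht (continuousOn_fracInt_right hγ P.continuous t)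
        (continuousOn_fracInt_right hγ Q.continuous t)]
    exact fracInt_congr ht fun s hs =>
      fracInt_add hγ hs.1 P.continuous.continuousOn Q.continuous.continuousOn
  | monomial n c =>
    simp only [Polynomial.eval_monomial, ← Real.rpow_natCast]
    have hn : (0 : ℝ) ≤ n := n.cast_nonneg
    rw [fracInt_const_mul, fracInt_rpow (add_nonneg hβ hγ) hn ht]
    rw [fracInt_congr ht (g := fun s => c * (Real.Gamma (n + 1) / Real.Gamma (n + 1 + γ)) *
      s ^ (n + γ)) fun s hs => by rw [fracInt_const_mul, fracInt_rpow hγ hn hs.1]; ring]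
    rw [fracInt_const_mul, fracInt_rpow hβ (by linarith) ht]
    have h1 : (n : ℝ) + γ + 1 = n + 1 + γ := by ring
    have h2 : (n : ℝ) + 1 + γ + β = n + 1 + (β + γ) := by ring
    have h3 : (n : ℝ) + γ + β = n + (β + γ) := by ring
    rw [h1, h2, h3]
    have := (Real.Gamma_pos_of_pos (show 0 < (n : ℝ) + 1 + γ by linarith)).ne'
    field_simp

/-- The semigroup property `I^β I^γ = I^(β + γ)`. Both sides are continuous in `f` for the sup norm
on `[0, t]`, and on polynomials the identity is the evaluation of Euler's Beta integral. -/
theorem fracInt_fracInt {β γ : ℝ} (hβ : 0 ≤ β) (hγ : 0 ≤ γ) {f : ℝ → ℝ} (hf : Continuous f)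
    {t : ℝ} (ht : 0 ≤ t) : fracInt β (fracInt γ f) t = fracInt (β + γ) f t := by
  set A := t ^ γ / Real.Gamma (γ + 1) * (t ^ β / Real.Gamma (β + 1))
  set B := t ^ (β + γ) / Real.Gamma (β + γ + 1)
  have hA : 0 ≤ A := mul_nonneg
    (div_nonneg (Real.rpow_nonneg ht _) (Real.Gamma_pos_of_pos (by linarith)).le)
    (div_nonneg (Real.rpow_nonneg ht _) (Real.Gamma_pos_of_pos (by linarith)).le)
  have hB : 0 ≤ B := div_nonneg (Real.rpow_nonneg ht _)
    (Real.Gamma_pos_of_pos (by linarith)).le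
  have key : ∀ ε > 0,
      |fracInt β (fracInt γ f) t - fracInt (β + γ) f t| ≤ ε * (A + B) := by
    intro ε hε
    obtain ⟨P, hP⟩ := exists_polynomial_near_of_continuousOn 0 t f hf.continuousOn ε hε
    have hPc := P.continuous
    have h1 : |fracInt β (fracInt γ fun s => P.eval s) t - fracInt β (fracInt γ f) t| ≤ ε * A := by
      rw [← fracInt_sub hβ ht (continuousOn_fracInt_right hγ hPc t)
        (continuousOn_fracInt_right hγ hf t)]
      refine (abs_fracInt_le hβ ht (M := ε * (t ^ γ / Real.Gamma (γ + 1))) fun s hs => ?_).trans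
        (by rw [mul_assoc])
      rw [← fracInt_sub hγ hs.1 hPc.continuousOn hf.continuousOn]
      refine (abs_fracInt_le hγ hs.1 (M := ε)
        fun r hr => (hP r ⟨hr.1, hr.2.trans hs.2⟩).le).trans ?_
      have : 0 < Real.Gamma (γ + 1) := Real.Gamma_pos_of_pos (by linarith)
      have := Real.rpow_le_rpow hs.1 hs.2 hγ
      gcongr
    have h2 : |fracInt (β + γ) (fun s => P.eval s) t - fracInt (β + γ) f t| ≤ ε * B := by
      rw [← fracInt_sub (add_nonneg hβ hγ) ht hPc.continuousOn hf.continuousOn]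
      exact abs_fracInt_le (add_nonneg hβ hγ) ht fun r hr => (hP r hr).le
    rw [fracInt_fracInt_polynomial hβ hγ P ht] at h1
    rw [abs_le] at *
    constructor <;> linarith [h1.1, h1.2, h2.1, h2.2]
  rw [← sub_eq_zero, ← abs_nonpos_iff]
  refine le_of_forall_pos_le_add fun ε hε => ?_
  refine (key (ε / (A + B + 1)) (by positivity)).trans ?_
  rw [zero_add, div_mul_eq_mul_div]
  exact (div_le_iff₀ (by positivity)).2 (by nlinarith)

/-! ### The Atangana–Baleanu derivative as a Neumann series -/

/-- Bounding Euler's integral from below on `(R, ∞)` gives growth faster than any exponential. -/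
theorem rpow_mul_exp_neg_le_Gamma {R s : ℝ} (hR : 0 < R) (hs : 0 ≤ s) :
    R ^ s * Real.exp (-R) ≤ Real.Gamma (s + 1) := by
  have hint := Real.GammaIntegral_convergent (s := s + 1) (by linarith)
  rw [Real.Gamma_eq_integral (by linarith), ← integral_exp_neg_Ioi, ← integral_const_mul]
  have hsub : Ioi R ⊆ Ioi (0 : ℝ) := Ioi_subset_Ioi hR.le
  calc ∫ x in Ioi R, R ^ s * Real.exp (-x)
      ≤ ∫ x in Ioi R, Real.exp (-x) * x ^ (s + 1 - 1) := by
        refine setIntegral_mono_on ((integrableOn_exp_neg_Ioi R).const_mul _)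
          (hint.mono_set hsub) measurableSet_Ioi fun x hx => ?_
        rw [add_sub_cancel_right, mul_comm]
        exact mul_le_mul_of_nonneg_left (Real.rpow_le_rpow hR.le (le_of_lt hx) hs)
          (Real.exp_pos _).le
    _ ≤ _ := by
        refine setIntegral_mono_set hint ?_ hsub.eventuallyLE
        refine (ae_restrict_iff' measurableSet_Ioi).2 (Filter.Eventually.of_forall fun x hx => ?_)
        exact mul_nonneg (Real.exp_pos _).le (Real.rpow_nonneg (le_of_lt hx) _)

theorem summable_pow_div_Gamma {β : ℝ} (hβ : 0 < β) {z : ℝ} (hz : 0 ≤ z) :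
    Summable fun n : ℕ => z ^ n / Real.Gamma (n * β + 1) := by
  -- `R` is chosen so that `R ^ β = 2 z + 1` dominates `z`.
  set R := (2 * z + 1) ^ (1 / β)
  have hR : 0 < R := Real.rpow_pos_of_pos (by linarith) _
  have hRβ : R ^ β = 2 * z + 1 := by
    rw [← Real.rpow_mul (by linarith), one_div_mul_cancel hβ.ne', Real.rpow_one]
  have hq : z / (2 * z + 1) < 1 := (div_lt_one (by linarith)).2 (by linarith)
  refine Summable.of_nonneg_of_le (fun n => ?_) (fun n => ?_)
    ((summable_geometric_of_lt_one (by positivity) hq).mul_left (Real.exp R))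
  · exact div_nonneg (pow_nonneg hz n) (Real.Gamma_pos_of_pos (by positivity)).le
  · have h := rpow_mul_exp_neg_le_Gamma hR (s := n * β) (by positivity)
    rw [mul_comm (n : ℝ) β, Real.rpow_mul hR.le, hRβ, Real.rpow_natCast] at h
    rw [mul_comm (n : ℝ) β]
    calc z ^ n / Real.Gamma (β * n + 1) ≤ z ^ n / ((2 * z + 1) ^ n * Real.exp (-R)) :=
          div_le_div_of_nonneg_left (pow_nonneg hz n) (by positivity) h
      _ = Real.exp R * (z / (2 * z + 1)) ^ n := by
          rw [Real.exp_neg, div_pow]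
          field_simp

theorem rpow_natCast_mul_eq {r : ℝ} (hr : 0 ≤ r) (n : ℕ) (β : ℝ) :
    r ^ (n * β) = (r ^ β) ^ n := by
  rw [mul_comm, Real.rpow_mul hr, Real.rpow_natCast]

theorem summable_mul_rpow_div_Gamma {β : ℝ} (hβ : 0 < β) {c r : ℝ} (hc : 0 ≤ c) (hr : 0 ≤ r) :
    Summable fun n : ℕ => c ^ n * (r ^ (n * β) / Real.Gamma (n * β + 1)) := by
  refine (summable_pow_div_Gamma hβ (z := c * r ^ β)
    (mul_nonneg hc (Real.rpow_nonneg hr _))).congr fun n => ?_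
  rw [rpow_natCast_mul_eq hr, mul_pow, mul_div_assoc]

/-- The Neumann series `(1 / (1 - β)) ∑ (-β / (1 - β))^n I^(n β) w`, that is, the solution `v` of the
Volterra equation `(1 - β) v + β I^β v = w`. -/
noncomputable def abSeries (β : ℝ) (w : ℝ → ℝ) (t : ℝ) : ℝ :=
  1 / (1 - β) * ∑' n : ℕ, (-(β / (1 - β))) ^ n * fracInt (n * β) w t

theorem abs_abSeries_term_le {β : ℝ} (hβ0 : 0 < β) (hβ1 : β < 1) {w : ℝ → ℝ} {M T t : ℝ}
    (ht : t ∈ Icc 0 T) (hM : ∀ s ∈ Icc 0 t, |w s| ≤ M) (n : ℕ) :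
    ‖(-(β / (1 - β))) ^ n * fracInt (n * β) w t‖ ≤
      (β / (1 - β)) ^ n * (T ^ (n * β) / Real.Gamma (n * β + 1)) * M := by
  have hc : 0 ≤ β / (1 - β) := div_nonneg hβ0.le (by linarith)
  have hM0 : 0 ≤ M := (abs_nonneg _).trans (hM 0 ⟨le_rfl, ht.1⟩)
  have hγ : 0 ≤ (n : ℝ) * β := by positivity
  have hΓ : 0 < Real.Gamma (n * β + 1) := Real.Gamma_pos_of_pos (by linarith)
  have hT := Real.rpow_le_rpow ht.1 ht.2 hγ
  rw [norm_mul, norm_pow, norm_neg, Real.norm_of_nonneg hc, mul_assoc, Real.norm_eq_abs]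
  refine mul_le_mul_of_nonneg_left ((abs_fracInt_le hγ ht.1 hM).trans ?_) (pow_nonneg hc n)
  rw [mul_comm]
  gcongr

theorem summable_abSeries_bound {β : ℝ} (hβ0 : 0 < β) (hβ1 : β < 1) {T : ℝ} (hT : 0 ≤ T)
    (M : ℝ) : Summable fun n : ℕ =>
      (β / (1 - β)) ^ n * (T ^ (n * β) / Real.Gamma (n * β + 1)) * M :=
  (summable_mul_rpow_div_Gamma hβ0 (div_nonneg hβ0.le (by linarith)) hT).mul_right M

theorem abSeries_congr {β : ℝ} {w₁ w₂ : ℝ → ℝ} {t : ℝ} (ht : 0 ≤ t)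
    (h : ∀ s ∈ Icc 0 t, w₁ s = w₂ s) : abSeries β w₁ t = abSeries β w₂ t := by
  unfold abSeries
  simp only [fracInt_congr ht h]

theorem continuousOn_abSeries {β : ℝ} (hβ0 : 0 < β) (hβ1 : β < 1) {w : ℝ → ℝ → ℝ}
    (hw : Continuous fun p : ℝ × ℝ => w p.1 p.2) {M : ℝ} (hM : ∀ x t, |w x t| ≤ M) (T : ℝ) :
    ContinuousOn (fun p : ℝ × ℝ => abSeries β (w p.1) p.2) (univ ×ˢ Icc 0 T) := by
  rcases lt_or_ge T 0 with hT | hT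
  · simp [Icc_eq_empty (not_le.2 hT)]
  refine continuousOn_const.mul (continuousOn_tsum (fun n => ?_)
    (summable_abSeries_bound hβ0 hβ1 hT M) fun n p hp =>
      abs_abSeries_term_le hβ0 hβ1 hp.2 (fun s _ => hM p.1 s) n)
  exact continuousOn_const.mul ((continuousOn_fracInt (by positivity) hw).mono
    (prod_mono_right Icc_subset_Ici_self))

theorem continuousOn_abSeries_right {β : ℝ} (hβ0 : 0 < β) (hβ1 : β < 1) {w : ℝ → ℝ}
    (hw : Continuous w) {M : ℝ} (hM : ∀ t, |w t| ≤ M) (T : ℝ) :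
    ContinuousOn (abSeries β w) (Icc 0 T) :=
  (continuousOn_abSeries hβ0 hβ1 (w := fun _ => w) (hw.comp continuous_snd)
    (fun _ t => hM t) T).comp (f := fun t : ℝ => ((0 : ℝ), t)) (by fun_prop)
    fun _ ht => ⟨mem_univ _, ht⟩

theorem hasSum_abSeries {β : ℝ} (hβ0 : 0 < β) (hβ1 : β < 1) {w : ℝ → ℝ} {M : ℝ}
    (hM : ∀ t, |w t| ≤ M) {t : ℝ} (ht : 0 ≤ t) :
    HasSum (fun n : ℕ => (-(β / (1 - β))) ^ n * fracInt (n * β) w t)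
      ((1 - β) * abSeries β w t) := by
  have h1 : 1 - β ≠ 0 := by linarith
  rw [abSeries, ← mul_assoc, mul_one_div_cancel h1, one_mul]
  exact (Summable.of_norm_bounded (summable_abSeries_bound hβ0 hβ1 ht M) fun n =>
    abs_abSeries_term_le hβ0 hβ1 ⟨ht, le_rfl⟩ (fun s _ => hM s) n).hasSum

/-- Integrating the Neumann series term by term shifts it by one index. -/
theorem hasSum_fracInt_abSeries {β : ℝ} (hβ0 : 0 < β) (hβ1 : β < 1) {w : ℝ → ℝ}
    (hw : Continuous w) {M : ℝ} (hM : ∀ t, |w t| ≤ M) {t : ℝ} (ht : 0 ≤ t) :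
    HasSum (fun n : ℕ => (-(β / (1 - β))) ^ n * fracInt ((n + 1 : ℕ) * β) w t)
      ((1 - β) * fracInt β (abSeries β w) t) := by
  have hterm : ∀ n : ℕ, (-(β / (1 - β))) ^ n * fracInt ((n + 1 : ℕ) * β) w t =
      1 / Real.Gamma β * ∫ s in (0 : ℝ)..t, (t - s) ^ (β - 1) *
        ((-(β / (1 - β))) ^ n * fracInt (n * β) w s) := by
    intro n
    have h := fracInt_fracInt hβ0.le (γ := n * β) (by positivity) hw ht
    rw [← fracInt_of_pos hβ0, fracInt_const_mul, h]
    congr 2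
    push_cast
    ring
  rw [← fracInt_const_mul, fracInt_of_pos hβ0]
  simp only [hterm]
  refine HasSum.mul_left _ ?_
  refine intervalIntegral.hasSum_integral_of_dominated_convergence
    (fun n s => (t - s) ^ (β - 1) *
      ((β / (1 - β)) ^ n * (t ^ (n * β) / Real.Gamma (n * β + 1)) * M)) ?_ ?_ ?_ ?_ ?_
  · intro n
    exact (intervalIntegrable_sub_rpow_mul hβ0 ht (continuousOn_const.mul
      (continuousOn_fracInt_right (by positivity) hw t)) t).def'.aestronglyMeasurable
  · intro n
    refine Filter.Eventually.of_forall fun s hs => ?_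
    rw [uIoc_of_le ht] at hs
    have h0 : 0 ≤ (t - s) ^ (β - 1) := Real.rpow_nonneg (by linarith [hs.2]) _
    rw [norm_mul, Real.norm_of_nonneg h0]
    exact mul_le_mul_of_nonneg_left (abs_abSeries_term_le hβ0 hβ1 ⟨hs.1.le, hs.2⟩
      (fun r _ => hM r) n) h0
  · exact Filter.Eventually.of_forall fun s _ =>
      (summable_abSeries_bound hβ0 hβ1 ht M).mul_left _
  · simp only [tsum_mul_left]
    exact (intervalIntegrable_sub_rpow hβ0 t 0 t).mul_const _
  · refine Filter.Eventually.of_forall fun s hs => ?_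
    rw [uIoc_of_le ht] at hs
    exact (hasSum_abSeries hβ0 hβ1 hM hs.1.le).mul_left _

/-- The Volterra equation satisfied by the Neumann series; this is the inversion formula of the
Atangana–Baleanu derivative. -/
theorem abSeries_add_fracInt_abSeries {β : ℝ} (hβ0 : 0 < β) (hβ1 : β < 1) {w : ℝ → ℝ}
    (hw : Continuous w) {M : ℝ} (hM : ∀ t, |w t| ≤ M) {t : ℝ} (ht : 0 ≤ t) :
    (1 - β) * abSeries β w t + β * fracInt β (abSeries β w) t = w t := by
  have h1 := hasSum_abSeries hβ0 hβ1 hM ht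
  have h2 := (hasSum_fracInt_abSeries hβ0 hβ1 hw hM ht).mul_left (-(β / (1 - β)))
  rw [← hasSum_nat_add_iff' 1] at h1
  have h3 := h1.unique (h2.congr_fun fun n => by simp only [pow_succ]; ring)
  have h4 : 1 - β ≠ 0 := by linarith
  simp only [Finset.range_one, Finset.sum_singleton, pow_zero, Nat.cast_zero, zero_mul, one_mul,
    fracInt_zero] at h3
  have h5 : -(β / (1 - β)) * ((1 - β) * fracInt β (abSeries β w) t) =
      -(β * fracInt β (abSeries β w) t) := by field_simp
  rw [h5] at h3
  linarith

/-- Integration by parts: `I^(γ + 1) f' = I^γ (f - f(0))`. -/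
theorem integral_deriv_mul_rpow {γ : ℝ} (hγ : 0 ≤ γ) {f : ℝ → ℝ} {t : ℝ} (ht : 0 ≤ t)
    (hf : ContinuousOn f (Icc 0 t)) (hd : ∀ s ∈ Ioo 0 t, DifferentiableAt ℝ f s)
    (hi : IntervalIntegrable (deriv f) volume 0 t) :
    ∫ s in (0 : ℝ)..t, deriv f s * ((t - s) ^ γ / Real.Gamma (γ + 1)) =
      fracInt γ (fun s => f s - f 0) t := by
  rcases hγ.eq_or_lt with rfl | hγ
  · simp only [Real.rpow_zero, zero_add, Real.Gamma_one, div_one, mul_one, fracInt_zero]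
    exact intervalIntegral.integral_eq_sub_of_hasDerivAt_of_le ht hf
      (fun s hs => (hd s hs).hasDerivAt) hi
  have hΓ := (Real.Gamma_pos_of_pos hγ).ne'
  have h := intervalIntegral.integral_mul_deriv_eq_deriv_mul_of_hasDerivAt
    (a := 0) (b := t) (u := fun s => (t - s) ^ γ) (u' := fun s => -γ * (t - s) ^ (γ - 1))
    (v := fun s => f s - f 0) (v' := deriv f)
    ((continuous_const.sub continuous_id).rpow_const fun _ => Or.inr hγ.le).continuousOn
    (by rw [uIcc_of_le ht]; exact hf.sub continuousOn_const)
    (fun s hs => by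
      rw [min_eq_left ht, max_eq_right ht] at hs
      have := ((hasDerivAt_id s).const_sub t).rpow_const (p := γ)
        (Or.inl (by simp only [id]; linarith [hs.2]))
      simpa using this)
    (fun s hs => by
      rw [min_eq_left ht, max_eq_right ht] at hs
      exact (hd s hs).hasDerivAt.sub_const _)
    ((intervalIntegrable_sub_rpow hγ t 0 t).const_mul _) hi
  simp only [sub_self, Real.zero_rpow hγ.ne', zero_mul, mul_zero, zero_sub, mul_assoc,
    intervalIntegral.integral_const_mul] at h
  rw [fracInt_of_pos hγ, Real.Gamma_add_one hγ.ne']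
  have h2 : ∫ s in (0 : ℝ)..t, deriv f s * ((t - s) ^ γ / (γ * Real.Gamma γ)) =
      (1 / (γ * Real.Gamma γ)) * ∫ s in (0 : ℝ)..t, (t - s) ^ γ * deriv f s := by
    rw [← intervalIntegral.integral_const_mul]
    exact intervalIntegral.integral_congr fun s _ => by ring
  rw [h2, h]
  field_simp

theorem hasSum_mittagLeffler {β : ℝ} (hβ : 0 < β) {c r : ℝ} (hc : 0 ≤ c) (hr : 0 ≤ r) :
    HasSum (fun n : ℕ => (-c) ^ n * (r ^ (n * β) / Real.Gamma (n * β + 1)))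
      (mittagLeffler β 1 (-c * r ^ β)) := by
  have h : ∀ n : ℕ, (-c * r ^ β) ^ n / Real.Gamma (β * n + 1) =
      (-c) ^ n * (r ^ (n * β) / Real.Gamma (n * β + 1)) := by
    intro n
    rw [rpow_natCast_mul_eq hr, mul_pow, mul_div_assoc, mul_comm β]
  rw [mittagLeffler]
  simp only [h]
  refine (Summable.of_norm ((summable_mul_rpow_div_Gamma hβ hc hr).congr fun n => ?_)).hasSum
  have : 0 ≤ r ^ (n * β) / Real.Gamma (n * β + 1) :=
    div_nonneg (Real.rpow_nonneg hr _) (Real.Gamma_pos_of_pos (by positivity)).le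
  rw [norm_mul, norm_pow, norm_neg, Real.norm_of_nonneg hc, Real.norm_of_nonneg this]

/-- Expanding the Mittag-Leffler kernel and integrating by parts in each term removes the
derivative of `f`, so that the right-hand side makes sense for every continuous `f`. -/
theorem abDeriv_eq_abSeries {β : ℝ} (hβ0 : 0 < β) (hβ1 : β < 1) {f : ℝ → ℝ} {t : ℝ} (ht : 0 ≤ t)
    (hf : ContinuousOn f (Icc 0 t)) (hd : ∀ s ∈ Ioo 0 t, DifferentiableAt ℝ f s)
    (hi : IntervalIntegrable (deriv f) volume 0 t) :
    abDeriv β 0 f t = abSeries β (fun s => f s - f 0) t := by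
  set c := β / (1 - β) with hc_def
  have hc : 0 ≤ c := div_nonneg hβ0.le (by linarith)
  have hz : ∀ s, -β * ((t - s) ^ β / (1 - β)) = -c * (t - s) ^ β := fun s => by
    rw [hc_def]; ring
  rw [abDeriv, abSeries]
  simp only [hz]
  congr 1
  symm
  have hcont : ∀ n : ℕ, Continuous fun s : ℝ =>
      (-c) ^ n * ((t - s) ^ (n * β) / Real.Gamma (n * β + 1)) := fun n =>
    continuous_const.mul (((continuous_const.sub continuous_id).rpow_const
      fun _ => Or.inr (by positivity)).div_const _)
  have hterm : ∀ n : ℕ, (-c) ^ n * fracInt (n * β) (fun s => f s - f 0) t =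
      ∫ s in (0 : ℝ)..t, deriv f s * ((-c) ^ n * ((t - s) ^ (n * β) / Real.Gamma (n * β + 1))) := by
    intro n
    rw [← integral_deriv_mul_rpow (by positivity) ht hf hd hi,
      ← intervalIntegral.integral_const_mul]
    exact intervalIntegral.integral_congr fun s _ => by ring
  simp only [← hc_def, hterm]
  refine HasSum.tsum_eq (intervalIntegral.hasSum_integral_of_dominated_convergence
    (fun n s => ‖deriv f s‖ * (c ^ n * (t ^ (n * β) / Real.Gamma (n * β + 1)))) ?_ ?_ ?_ ?_ ?_)
  · exact fun n => (hi.mul_continuousOn (hcont n).continuousOn).def'.aestronglyMeasurable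
  · intro n
    refine Filter.Eventually.of_forall fun s hs => ?_
    rw [uIoc_of_le ht] at hs
    have hts : 0 ≤ t - s := by linarith [hs.2]
    have hΓ : 0 < Real.Gamma (n * β + 1) := Real.Gamma_pos_of_pos (by positivity)
    rw [norm_mul, norm_mul, norm_pow, norm_neg, Real.norm_of_nonneg hc,
      Real.norm_of_nonneg (div_nonneg (Real.rpow_nonneg hts _) hΓ.le)]
    have := Real.rpow_le_rpow hts (show t - s ≤ t by linarith [hs.1])
      (show 0 ≤ (n : ℝ) * β by positivity)
    gcongr
  · exact Filter.Eventually.of_forall fun s _ => (summable_mul_rpow_div_Gamma hβ0 hc ht).mul_left _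
  · simp only [tsum_mul_left]
    exact hi.norm.mul_const _
  · refine Filter.Eventually.of_forall fun s hs => ?_
    rw [uIoc_of_le ht] at hs
    exact (hasSum_mittagLeffler hβ0 hc (by linarith [hs.2])).mul_left _

/-! ### The Volterra equation at a minimum -/

/-- At a minimum `t₀` of `v` over `[0, t₀]`, the quantity `(1 - β) v + β I^β v` increases into `t₀`
at most as it would if `v` were the constant `v t₀`, along some `t₁` arbitrarily close to `t₀`. -/
theorem exists_volterra_sub_le_of_min {β : ℝ} (hβ0 : 0 < β) (hβ1 : β < 1) {v : ℝ → ℝ} {t₀ : ℝ}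
    (ht₀ : 0 < t₀) (hv : ContinuousOn v (Icc 0 t₀)) (hmin : ∀ s ∈ Icc 0 t₀, v t₀ ≤ v s) {ε : ℝ}
    (hε : 0 < ε) :
    ∃ t₁ ∈ Ico 0 t₀, t₀ - ε < t₁ ∧
      ((1 - β) * v t₀ + β * fracInt β v t₀) - ((1 - β) * v t₁ + β * fracInt β v t₁) ≤
        v t₀ * (t₀ ^ β - t₁ ^ β) / Real.Gamma β := by
  have hΓ : 0 < Real.Gamma β := Real.Gamma_pos_of_pos hβ0
  have hA : 0 < (1 - β) * Real.Gamma β := mul_pos (by linarith) hΓ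
  set δ := min (ε / 2) (min t₀ (((1 - β) * Real.Gamma β) ^ (1 / β)))
  have hδ : 0 < δ := lt_min (by linarith) (lt_min ht₀ (Real.rpow_pos_of_pos hA _))
  have hδε : δ ≤ ε / 2 := min_le_left _ _
  have hδt : δ ≤ t₀ := (min_le_right _ _).trans (min_le_left _ _)
  have hδβ : δ ^ β ≤ (1 - β) * Real.Gamma β := by
    calc δ ^ β ≤ (((1 - β) * Real.Gamma β) ^ (1 / β)) ^ β :=
          Real.rpow_le_rpow hδ.le ((min_le_right _ _).trans (min_le_right _ _)) hβ0.le
      _ = _ := by rw [← Real.rpow_mul hA.le, one_div_mul_cancel hβ0.ne', Real.rpow_one]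
  -- With `t₁` a maximum point of `v` on `[t₀ - δ, t₀]`, the drop `v t₀ - v t₁` outweighs the
  -- contribution of `(t₁, t₀)` to the fractional integral.
  obtain ⟨t₁, ht₁, ht₁₀, hmax⟩ : ∃ t₁, t₀ - δ ≤ t₁ ∧ t₁ < t₀ ∧ ∀ s ∈ Icc t₁ t₀, v s ≤ v t₁ := by
    obtain ⟨m, hm, hmm⟩ := isCompact_Icc.exists_isMaxOn
      (nonempty_Icc.2 (show t₀ - δ ≤ t₀ by linarith))
      (hv.mono (Icc_subset_Icc_left (show 0 ≤ t₀ - δ by linarith)))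
    rcases hm.2.eq_or_lt with h | h
    · refine ⟨t₀ - δ, le_rfl, by linarith, fun s hs => (hmm hs).trans ?_⟩
      subst h
      exact hmin _ ⟨by linarith, by linarith⟩
    · exact ⟨m, hm.1, h, fun s hs => hmm ⟨hm.1.trans hs.1, hs.2⟩⟩
  have h10 : 0 ≤ t₁ := by linarith
  refine ⟨t₁, ⟨h10, ht₁₀⟩, by linarith, ?_⟩
  have hv1 : ContinuousOn v (Icc 0 t₁) := hv.mono (Icc_subset_Icc_right ht₁₀.le)
  have hv2 : ContinuousOn v (Icc t₁ t₀) := hv.mono (Icc_subset_Icc_left h10)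
  have e1 : ∫ s in t₁..t₀, (t₀ - s) ^ (β - 1) * v s ≤ v t₁ * ((t₀ - t₁) ^ β / β) := by
    have h := intervalIntegral.integral_mono_on ht₁₀.le
      (intervalIntegrable_sub_rpow_mul hβ0 ht₁₀.le hv2 t₀)
      ((intervalIntegrable_sub_rpow hβ0 t₀ t₁ t₀).mul_const (v t₁)) fun s hs =>
        mul_le_mul_of_nonneg_left (hmax s hs)
          (Real.rpow_nonneg (show 0 ≤ t₀ - s by linarith [hs.2]) (β - 1))
    rwa [intervalIntegral.integral_mul_const, integral_sub_rpow hβ0, sub_self,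
      Real.zero_rpow hβ0.ne', sub_zero, mul_comm] at h
  have e2 : (∫ s in (0 : ℝ)..t₁, (t₀ - s) ^ (β - 1) * v s) -
      ∫ s in (0 : ℝ)..t₁, (t₁ - s) ^ (β - 1) * v s ≤
        v t₀ * ((t₀ ^ β - (t₀ - t₁) ^ β) / β - t₁ ^ β / β) := by
    have i1 := intervalIntegrable_sub_rpow_mul hβ0 h10 hv1 t₀
    have i2 := intervalIntegrable_sub_rpow_mul hβ0 h10 hv1 t₁
    have j1 := (intervalIntegrable_sub_rpow hβ0 t₀ 0 t₁).mul_const (v t₀)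
    have j2 := (intervalIntegrable_sub_rpow hβ0 t₁ 0 t₁).mul_const (v t₀)
    have h := intervalIntegral.integral_mono_on_of_le_Ioo h10 (i1.sub i2) (j1.sub j2)
      fun s hs => by
        have hk : (t₀ - s) ^ (β - 1) ≤ (t₁ - s) ^ (β - 1) :=
          Real.rpow_le_rpow_of_nonpos (by linarith [hs.2]) (by linarith) (by linarith)
        have := hmin s ⟨hs.1.le, by linarith [hs.2]⟩
        nlinarith
    rw [intervalIntegral.integral_sub i1 i2, intervalIntegral.integral_sub j1 j2,
      intervalIntegral.integral_mul_const, intervalIntegral.integral_mul_const,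
      integral_sub_rpow hβ0, integral_sub_rpow hβ0, sub_self, Real.zero_rpow hβ0.ne',
      sub_zero, sub_zero, sub_zero] at h
    linarith
  have e3 := intervalIntegral.integral_add_adjacent_intervals
    (intervalIntegrable_sub_rpow_mul hβ0 h10 hv1 t₀)
    (intervalIntegrable_sub_rpow_mul hβ0 ht₁₀.le hv2 t₀)
  have hdrop : 0 ≤ v t₁ - v t₀ := sub_nonneg.2 (hmin t₁ ⟨h10, ht₁₀.le⟩)
  have hpow : (t₀ - t₁) ^ β ≤ (1 - β) * Real.Gamma β :=
    (Real.rpow_le_rpow (by linarith) (by linarith) hβ0.le).trans hδβ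
  rw [fracInt_of_pos hβ0, fracInt_of_pos hβ0, ← e3]
  set I₁ := ∫ s in (0 : ℝ)..t₁, (t₀ - s) ^ (β - 1) * v s
  set I₂ := ∫ s in t₁..t₀, (t₀ - s) ^ (β - 1) * v s
  set I₃ := ∫ s in (0 : ℝ)..t₁, (t₁ - s) ^ (β - 1) * v s
  rw [le_div_iff₀ hΓ]
  have e4 : ((1 - β) * v t₀ + β * (1 / Real.Gamma β * (I₁ + I₂)) -
      ((1 - β) * v t₁ + β * (1 / Real.Gamma β * I₃))) * Real.Gamma β =
      -((1 - β) * Real.Gamma β) * (v t₁ - v t₀) + β * (I₁ - I₃ + I₂) := by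
    field_simp
    ring
  have e5 : β * (I₁ - I₃ + I₂) ≤
      v t₀ * (t₀ ^ β - t₁ ^ β) + (t₀ - t₁) ^ β * (v t₁ - v t₀) := by
    calc β * (I₁ - I₃ + I₂) ≤ β * (v t₀ * ((t₀ ^ β - (t₀ - t₁) ^ β) / β - t₁ ^ β / β) +
          v t₁ * ((t₀ - t₁) ^ β / β)) :=
        mul_le_mul_of_nonneg_left (add_le_add e2 e1) hβ0.le
      _ = _ := by field_simp; ring
  rw [e4]
  nlinarith [mul_le_mul_of_nonneg_right hpow hdrop]

theorem exists_lt_of_volterra_of_neg_min {β : ℝ} (hβ0 : 0 < β) (hβ1 : β < 1) {v w : ℝ → ℝ}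
    {t₀ : ℝ} (ht₀ : 0 < t₀) (hv : ContinuousOn v (Icc 0 t₀))
    (hw : ∀ t ∈ Icc 0 t₀, (1 - β) * v t + β * fracInt β v t = w t)
    (hmin : ∀ s ∈ Icc 0 t₀, v t₀ ≤ v s) (hneg : v t₀ < 0) : ∃ t₁ ∈ Ico 0 t₀, w t₀ < w t₁ := by
  obtain ⟨t₁, ht₁, -, h⟩ := exists_volterra_sub_le_of_min hβ0 hβ1 ht₀ hv hmin one_pos
  refine ⟨t₁, ht₁, ?_⟩
  rw [hw t₀ ⟨ht₀.le, le_rfl⟩, hw t₁ ⟨ht₁.1, ht₁.2.le⟩] at h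
  have := Real.rpow_lt_rpow ht₁.1 ht₁.2 hβ0
  have : v t₀ * (t₀ ^ β - t₁ ^ β) / Real.Gamma β < 0 :=
    div_neg_of_neg_of_pos (mul_neg_of_neg_of_pos hneg (by linarith)) (Real.Gamma_pos_of_pos hβ0)
  linarith

theorem derivWithin_neg_of_volterra_of_neg_min {β : ℝ} (hβ0 : 0 < β) (hβ1 : β < 1) {v w : ℝ → ℝ}
    {t₀ : ℝ} (ht₀ : 0 < t₀) (hv : ContinuousOn v (Icc 0 t₀))
    (hw : ∀ t ∈ Icc 0 t₀, (1 - β) * v t + β * fracInt β v t = w t)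
    (hmin : ∀ s ∈ Icc 0 t₀, v t₀ ≤ v s) (hneg : v t₀ < 0) {d : ℝ}
    (hd : HasDerivWithinAt w d (Icc 0 t₀) t₀) : d < 0 := by
  by_contra! hd0
  have hΓ : 0 < Real.Gamma β := Real.Gamma_pos_of_pos hβ0
  -- Subtracting the value for constant `v` leaves a function with positive left derivative at `t₀`.
  have hP : HasDerivWithinAt (fun t => w t - v t₀ / Real.Gamma β * t ^ β)
      (d - v t₀ / Real.Gamma β * (β * t₀ ^ (β - 1))) (Ico 0 t₀) t₀ :=
    (hd.mono Ico_subset_Icc_self).sub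
      ((Real.hasDerivAt_rpow_const (Or.inl ht₀.ne')).hasDerivWithinAt.const_mul _)
  rw [hasDerivWithinAt_iff_tendsto_slope' (fun h => lt_irrefl _ h.2)] at hP
  have hpos : 0 < d - v t₀ / Real.Gamma β * (β * t₀ ^ (β - 1)) := by
    have : v t₀ / Real.Gamma β * (β * t₀ ^ (β - 1)) < 0 :=
      mul_neg_of_neg_of_pos (div_neg_of_neg_of_pos hneg hΓ)
        (mul_pos hβ0 (Real.rpow_pos_of_pos ht₀ _))
    linarith
  obtain ⟨ε, hε, hball⟩ := Metric.mem_nhdsWithin_iff.1 (hP.eventually (lt_mem_nhds hpos))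
  obtain ⟨t₁, ht₁, hεt, h⟩ := exists_volterra_sub_le_of_min hβ0 hβ1 ht₀ hv hmin hε
  rw [hw t₀ ⟨ht₀.le, le_rfl⟩, hw t₁ ⟨ht₁.1, ht₁.2.le⟩] at h
  have hs : 0 < slope (fun t => w t - v t₀ / Real.Gamma β * t ^ β) t₀ t₁ := by
    refine hball ⟨?_, ht₁⟩
    rw [Metric.mem_ball, Real.dist_eq, abs_sub_comm, abs_of_pos (sub_pos.2 ht₁.2)]
    linarith
  rw [slope_comm, slope_def_field] at hs
  have h2 := (div_pos_iff_of_pos_right (sub_pos.2 ht₁.2)).1 hs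
  have h3 : v t₀ * (t₀ ^ β - t₁ ^ β) / Real.Gamma β =
      v t₀ / Real.Gamma β * t₀ ^ β - v t₀ / Real.Gamma β * t₁ ^ β := by ring
  linarith

theorem deriv_deriv_nonneg_of_isLocalMin {f : ℝ → ℝ} {x : ℝ} (h : IsLocalMin f x)
    (hc : ContinuousAt f x) : 0 ≤ deriv (deriv f) x := by
  by_contra! hneg
  have hmax := isLocalMax_of_deriv_deriv_neg hneg h.deriv_eq_zero hc
  have hconst : f =ᶠ[nhds x] fun _ => f x := by
    filter_upwards [h, hmax] with y h1 h2 using le_antisymm h2 h1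
  have h0 : deriv (deriv f) x = 0 := by
    have := hconst.deriv.deriv_eq
    simpa using this
  exact hneg.ne h0

/-! ### Extension of the Atangana–Baleanu derivative to the closed rectangle -/

/-- The projection of the line onto `[0, b]`. -/
def clamp (b s : ℝ) : ℝ := max 0 (min s b)

theorem continuous_clamp (b : ℝ) : Continuous (clamp b) := by
  unfold clamp
  fun_prop

theorem clamp_mem {b : ℝ} (hb : 0 ≤ b) (s : ℝ) : clamp b s ∈ Icc 0 b :=
  ⟨le_max_left _ _, max_le hb (min_le_right _ _)⟩

theorem clamp_of_mem {b s : ℝ} (hs : s ∈ Icc 0 b) : clamp b s = s := by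
  rw [clamp, min_eq_left hs.2, max_eq_right hs.1]

/-- The increment `u(x, t) - u(x, 0)`, extended from `[0, a] × [0, T]` to the plane by projecting
`x` and `t` onto their intervals, so that it is continuous and bounded everywhere. -/
def increment (a T : ℝ) (u : ℝ → ℝ → ℝ) (x t : ℝ) : ℝ :=
  u (clamp a x) (clamp T t) - u (clamp a x) 0

theorem increment_of_mem {a T : ℝ} {u : ℝ → ℝ → ℝ} {x t : ℝ} (hx : x ∈ Icc 0 a)
    (ht : t ∈ Icc 0 T) : increment a T u x t = u x t - u x 0 := by
  rw [increment, clamp_of_mem hx, clamp_of_mem ht]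

theorem continuous_increment {a T : ℝ} (ha : 0 ≤ a) (hT : 0 ≤ T) {u : ℝ → ℝ → ℝ}
    (hu : ContinuousOn (fun p : ℝ × ℝ => u p.1 p.2) (Icc 0 a ×ˢ Icc 0 T)) :
    Continuous fun p : ℝ × ℝ => increment a T u p.1 p.2 := by
  have h1 : Continuous fun p : ℝ × ℝ => (clamp a p.1, clamp T p.2) :=
    ((continuous_clamp a).comp continuous_fst).prodMk ((continuous_clamp T).comp continuous_snd)
  have h2 : Continuous fun p : ℝ × ℝ => (clamp a p.1, (0 : ℝ)) :=
    ((continuous_clamp a).comp continuous_fst).prodMk continuous_const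
  exact (hu.comp_continuous h1 fun p => ⟨clamp_mem ha _, clamp_mem hT _⟩).sub
    (hu.comp_continuous h2 fun p => ⟨clamp_mem ha _, ⟨le_rfl, hT⟩⟩)

theorem exists_abs_increment_le {a T : ℝ} (ha : 0 ≤ a) (hT : 0 ≤ T) {u : ℝ → ℝ → ℝ}
    (hu : ContinuousOn (fun p : ℝ × ℝ => u p.1 p.2) (Icc 0 a ×ˢ Icc 0 T)) :
    ∃ M, ∀ x t, |increment a T u x t| ≤ M := by
  obtain ⟨C, hC⟩ := (isCompact_Icc.prod isCompact_Icc).exists_bound_of_continuousOn hu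
  refine ⟨C + C, fun x t => (abs_sub _ _).trans (add_le_add ?_ ?_)⟩
  · exact hC (clamp a x, clamp T t) ⟨clamp_mem ha _, clamp_mem hT _⟩
  · exact hC (clamp a x, 0) ⟨clamp_mem ha _, ⟨le_rfl, hT⟩⟩

theorem IsClassicalSolution.abTime_eq_abSeries {α a T : ℝ} (hα0 : 0 < α) (hα1 : α < 1)
    {F : ℝ → ℝ → ℝ} {φ lam mu : ℝ → ℝ} {u : ℝ → ℝ → ℝ}
    (hu : IsClassicalSolution α a T F φ lam mu u) {x t : ℝ} (hx : x ∈ Ioo 0 a)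
    (ht : t ∈ Ioc 0 T) : abTime α u x t = abSeries (1 - α) (increment a T u x) t := by
  have hxI : x ∈ Icc 0 a := Ioo_subset_Icc_self hx
  have hnhds : ∀ s ∈ Ioo 0 t, Icc 0 T ∈ nhds s := fun s hs =>
    Icc_mem_nhds hs.1 (hs.2.trans_le ht.2)
  have hcont : ContinuousOn (fun s => u x s) (Icc 0 t) :=
    hu.continuous.comp (f := fun s : ℝ => (x, s)) (by fun_prop)
      fun s hs => ⟨hxI, hs.1, hs.2.trans ht.2⟩
  have hint : IntervalIntegrable (deriv fun s => u x s) volume 0 t := by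
    rw [intervalIntegrable_iff_integrableOn_Ioo_of_le ht.1.le]
    refine IntegrableOn.congr_fun ((hu.integrable_t x hx).mono_set
      (Ioo_subset_Ioc_self.trans (Ioc_subset_Ioc_right ht.2))) (fun s hs => ?_) measurableSet_Ioo
    exact derivWithin_of_mem_nhds (hnhds s hs)
  rw [abTime, abDeriv_eq_abSeries (by linarith) (by linarith) ht.1.le hcont (fun s hs =>
    (hu.isC21.differentiable_t x hx s ⟨hs.1, (hs.2.le.trans ht.2)⟩).differentiableAt
      (hnhds s hs)) hint]
  exact abSeries_congr ht.1.le fun s hs =>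
    (increment_of_mem hxI ⟨hs.1, hs.2.trans ht.2⟩).symm

/-! ### The minimum principle -/

/-- The Atangana–Baleanu derivative of a classical solution, continuously extended to the closed
rectangle, is nonnegative there. -/
theorem IsClassicalSolution.abSeries_nonneg {α a T : ℝ} (hα0 : 0 < α) (hα1 : α < 1) (ha : 0 < a)
    (hT : 0 < T) {F : ℝ → ℝ → ℝ} {φ lam mu : ℝ → ℝ} {u : ℝ → ℝ → ℝ}
    (hlam : MonotoneOn lam (Icc 0 T)) (hmu : MonotoneOn mu (Icc 0 T))
    (hu : IsClassicalSolution α a T F φ lam mu u)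
    (hF : ∀ x ∈ Icc 0 a, ∀ t ∈ Icc 0 T, 0 ≤ F x t) :
    ∀ x ∈ Icc 0 a, ∀ t ∈ Icc 0 T, 0 ≤ abSeries (1 - α) (increment a T u x) t := by
  have hβ0 : 0 < 1 - α := by linarith
  have hβ1 : 1 - α < 1 := by linarith
  set V : ℝ → ℝ → ℝ := fun x t => abSeries (1 - α) (increment a T u x) t with hV
  have hWc := continuous_increment ha.le hT.le hu.continuous
  obtain ⟨M, hM⟩ := exists_abs_increment_le ha.le hT.le hu.continuous
  have hVc : ContinuousOn (fun p : ℝ × ℝ => V p.1 p.2) (univ ×ˢ Icc 0 T) :=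
    continuousOn_abSeries hβ0 hβ1 hWc hM T
  have hWx : ∀ x, Continuous (increment a T u x) := fun x =>
    hWc.comp (continuous_const.prodMk continuous_id)
  obtain ⟨⟨x₀, t₀⟩, ⟨hx₀, ht₀⟩, hmin⟩ := (isCompact_Icc.prod isCompact_Icc).exists_isMinOn
    ((nonempty_Icc.2 ha.le).prod (nonempty_Icc.2 hT.le))
    (hVc.mono (prod_mono_left (subset_univ (Icc 0 a))))
  simp only at hx₀ ht₀
  have hmin' : ∀ x ∈ Icc 0 a, ∀ t ∈ Icc 0 T, V x₀ t₀ ≤ V x t := fun x hx t ht =>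
    isMinOn_iff.1 hmin (x, t) ⟨hx, ht⟩
  suffices h : 0 ≤ V x₀ t₀ from fun x hx t ht => h.trans (hmin' x hx t ht)
  by_contra! hneg
  have hvol : ∀ x t, 0 ≤ t → (1 - (1 - α)) * V x t + (1 - α) * fracInt (1 - α) (V x) t =
      increment a T u x t := fun x t ht => abSeries_add_fracInt_abSeries hβ0 hβ1 (hWx x) (hM x) ht
  have ht₀pos : 0 < t₀ := by
    refine ht₀.1.lt_of_ne fun h => ?_
    subst h
    have h0 := hvol x₀ 0 le_rfl
    rw [fracInt_of_pos hβ0, intervalIntegral.integral_same, increment_of_mem hx₀ ht₀] at h0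
    have : α * V x₀ 0 = 0 := by linarith
    exact hneg.ne ((mul_eq_zero.1 this).resolve_left hα0.ne')
  have hsub : Icc 0 t₀ ⊆ Icc 0 T := Icc_subset_Icc_right ht₀.2
  have hVt : ContinuousOn (V x₀) (Icc 0 t₀) :=
    (continuousOn_abSeries_right hβ0 hβ1 (hWx x₀) (hM x₀) T).mono hsub
  have hw : ∀ t ∈ Icc 0 t₀, (1 - (1 - α)) * V x₀ t + (1 - α) * fracInt (1 - α) (V x₀) t =
      u x₀ t - u x₀ 0 := fun t ht => by
    rw [hvol x₀ t ht.1, increment_of_mem hx₀ (hsub ht)]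
  have hmint : ∀ s ∈ Icc 0 t₀, V x₀ t₀ ≤ V x₀ s := fun s hs => hmin' x₀ hx₀ s (hsub hs)
  obtain ⟨t₁, ht₁, hlt⟩ := exists_lt_of_volterra_of_neg_min hβ0 hβ1 ht₀pos hVt hw hmint hneg
  have ht₁T : t₁ ∈ Icc 0 T := hsub ⟨ht₁.1, ht₁.2.le⟩
  rcases hx₀.1.eq_or_lt with h | hx0
  · subst h
    rw [hu.boundary_left _ ht₀, hu.boundary_left _ ht₁T] at hlt
    linarith [hlam ht₁T ht₀ ht₁.2.le]
  rcases hx₀.2.eq_or_lt with h | hxa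
  · subst h
    rw [hu.boundary_right _ ht₀, hu.boundary_right _ ht₁T] at hlt
    linarith [hmu ht₁T ht₀ ht₁.2.le]
  have hx₀I : x₀ ∈ Ioo 0 a := ⟨hx0, hxa⟩
  have ht₀I : t₀ ∈ Ioc 0 T := ⟨ht₀pos, ht₀.2⟩
  have hdt := (hu.isC21.differentiable_t x₀ hx₀I t₀ ht₀I).hasDerivWithinAt
  have hdneg := derivWithin_neg_of_volterra_of_neg_min hβ0 hβ1 ht₀pos hVt hw hmint hneg
    ((hdt.mono hsub).sub_const _)
  have hloc : IsLocalMin (fun y => abTime α u y t₀) x₀ := by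
    filter_upwards [Ioo_mem_nhds hx0 hxa] with y hy
    rw [hu.abTime_eq_abSeries hα0 hα1 hx₀I ht₀I, hu.abTime_eq_abSeries hα0 hα1 hy ht₀I]
    exact hmin' y (Ioo_subset_Icc_self hy) t₀ ht₀
  have hxx : 0 ≤ dx (dx (abTime α u)) x₀ t₀ := deriv_deriv_nonneg_of_isLocalMin hloc
    (hu.ab_differentiable_x x₀ hx₀I t₀ ht₀I).continuousAt
  have heq := hu.equation x₀ hx₀I t₀ ht₀I
  rw [dt] at heq
  linarith [hF x₀ hx₀ t₀ ht₀]

end ABDiffusion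

theorem theoremt1 (α a T : ℝ) (hα0 : 0 < α) (hα1 : α < 1) (ha : 0 < a) (hT : 0 < T)
    (F : ℝ → ℝ → ℝ) (φ lam mu : ℝ → ℝ) (u : ℝ → ℝ → ℝ)
    (hFcont : ContinuousOn (fun p : ℝ × ℝ => F p.1 p.2) (Set.Icc 0 a ×ˢ Set.Icc 0 T))
    (hφcont : ContinuousOn φ (Set.Icc 0 a))
    (hlamcont : ContinuousOn lam (Set.Icc 0 T))
    (hmucont : ContinuousOn mu (Set.Icc 0 T))
    (hlam : MonotoneOn lam (Set.Icc 0 T))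
    (hmu : MonotoneOn mu (Set.Icc 0 T))
    (hu : ABDiffusion.IsClassicalSolution α a T F φ lam mu u)
    (hF : ∀ x ∈ Set.Icc 0 a, ∀ t ∈ Set.Icc 0 T, 0 ≤ F x t) :
    ∃ m : ℝ,
      IsLeast (lam '' Set.Icc 0 T ∪ mu '' Set.Icc 0 T ∪ φ '' Set.Icc 0 a) m ∧
      ∀ x ∈ Set.Icc 0 a, ∀ t ∈ Set.Icc 0 T, m ≤ u x t := by
  obtain ⟨m, hm⟩ := (((isCompact_Icc.image_of_continuousOn hlamcont).union
    (isCompact_Icc.image_of_continuousOn hmucont)).union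
    (isCompact_Icc.image_of_continuousOn hφcont)).exists_isLeast
    ⟨φ 0, Or.inr ⟨0, ⟨le_rfl, ha.le⟩, rfl⟩⟩
  refine ⟨m, hm, fun x hx t ht => ?_⟩
  have hβ0 : 0 < 1 - α := by linarith
  have hV := hu.abSeries_nonneg hα0 hα1 ha hT hlam hmu hF x hx
  obtain ⟨M, hM⟩ := ABDiffusion.exists_abs_increment_le ha.le hT.le hu.continuous
  have hWx : Continuous (ABDiffusion.increment a T u x) :=
    (ABDiffusion.continuous_increment ha.le hT.le hu.continuous).comp
      (continuous_const.prodMk continuous_id)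
  have hvol := ABDiffusion.abSeries_add_fracInt_abSeries hβ0 (by linarith) hWx (hM x) ht.1
  rw [ABDiffusion.increment_of_mem hx ht, hu.initial x hx] at hvol
  have hI := ABDiffusion.fracInt_nonneg hβ0.le ht.1 fun s hs => hV s ⟨hs.1, hs.2.trans ht.2⟩
  have h1 : 0 ≤ (1 - (1 - α)) * ABDiffusion.abSeries (1 - α) (ABDiffusion.increment a T u x) t :=
    mul_nonneg (by linarith) (hV t ht)
  have h2 := mul_nonneg hβ0.le hI
  have h3 : m ≤ φ x := hm.2 (Or.inr ⟨x, hx, rfl⟩)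
  linarith
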